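/- Let $\Omega\subset\mathbb C$ be a Borel set, $\lambda$ Lebesgue measure, and let $M_f$ denote multiplication by $f\in L^\infty(\Omega,\lambda)$ on the Hilbert space $L^2(\Omega,\lambda)$ of complex-valued functions. Put $Df(s,t)=\frac{f(s)-f(t)}{s-t}$ for $s\ne t$, and $$\Lambda(\Omega)=\{f\in L^\infty(\Omega,\lambda) : Df\in L^\infty(\Omega\times\Omega,\lambda\otimes\lambda)\}.$$ For a bounded operator $T$ on $L^2(\Omega,\lambda)$ let $$L(T)=\sup\{|[M_f,T]|_2 : f\in\Lambda(\Omega),\ \|Df\|_\infty\le 1\}\in[0,\infty],$$ where $|\cdot|_2$ is the Hilbert--Schmidt norm ($=\infty$ for operators that are not Hilbert--Schmidt). Let $E\Lambda(\Omega)$ be the algebra of all bounded operators $T$ on $L^2(\Omega,\lambda)$ with $L(T)<\infty$, and let $\mathcal K\Lambda(\Omega)$ be the ideal of compact operators in $E\Lambda(\Omega)$, with the norm $|||T|||=\|T\|+L(T)$. Let $\mathcal M(\mathcal K\Lambda(\Omega))$ be the algebra of double centralizers of $\mathcal K\Lambda(\Omega)$, that is, of pairs $(T',T'')$ of $|||\cdot|||$-bounded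 linear maps $\mathcal K\Lambda(\Omega)\to\mathcal K\Lambda(\Omega)$ such that $T'(x)y=xT''(y)$ for all $x,y\in\mathcal K\Lambda(\Omega)$, with product $(S',S'')(T',T'')=(T'\circ S',\,S''\circ T'')$. Then $\mathcal M(\mathcal K\Lambda(\Omega))=E\Lambda(\Omega)$. That is, $T\mapsto(x\mapsto xT,\ x\mapsto Tx)$ is an isomorphism of complex algebras from $E\Lambda(\Omega)$ onto $\mathcal M(\mathcal K\Lambda(\Omega))$; in particular, for every $(T',T'')\in\mathcal M(\mathcal K\Lambda(\Omega))$ there is a unique $T\in E\Lambda(\Omega)$ such that $T'(x)=xT$ and $T''(x)=Tx$ for all $x\in\mathcal K\Lambda(\Omega)$. -/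

import Mathlib

open MeasureTheory
open scoped ENNReal MultiplierAlgebra

noncomputable section

section HilbertSchmidt

variable {H : Type*} [NormedAddCommGroup H] [InnerProductSpace ℂ H] [CompleteSpace H]

/-- An index set for an orthonormal basis of `H`. -/
def hsIndex (H : Type*) [NormedAddCommGroup H] [InnerProductSpace ℂ H] [CompleteSpace H] :
    Set H :=
  (exists_hilbertBasis ℂ H).choose

/-- Some orthonormal basis of `H`. -/
def hsBasis (H : Type*) [NormedAddCommGroup H] [InnerProductSpace ℂ H] [CompleteSpace H] :
    HilbertBasis (hsIndex H) ℂ H :=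
  (exists_hilbertBasis ℂ H).choose_spec.choose

/-- The Hilbert-Schmidt norm `|T|₂ = Tr(T*T)^{1/2} = (∑ ‖T eᵢ‖²)^{1/2}`, with value `∞` if `T` is
not a Hilbert-Schmidt operator. It does not depend on the orthonormal basis, see
`hsNorm_eq_of_basis`. -/
def hsNorm (T : H →L[ℂ] H) : ℝ≥0∞ :=
  (∑' i, ‖T (hsBasis H i)‖ₑ ^ (2 : ℝ)) ^ (1 / 2 : ℝ)

lemma enorm_sq_eq_tsum {ι : Type*} (b : HilbertBasis ι ℂ H) (x : H) :
    ‖x‖ₑ ^ (2 : ℝ) = ∑' i, ‖inner ℂ (b i) x‖ₑ ^ (2 : ℝ) := by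
  have h := b.hasSum_inner_mul_inner x x
  have h2 : HasSum (fun i => ‖inner ℂ (b i) x‖ ^ 2) (‖x‖ ^ 2) := by
    have h3 := Complex.reCLM.hasSum h
    convert! h3 using 1
    · funext i
      simp only [Complex.reCLM_apply]
      rw [← inner_conj_symm x (b i), ← Complex.normSq_eq_conj_mul_self, Complex.ofReal_re,
        Complex.normSq_eq_norm_sq]
    · simpa using (inner_self_eq_norm_sq (𝕜 := ℂ) x).symm
  have h4 := ENNReal.ofReal_tsum_of_nonneg (fun i => by positivity) h2.summable
  rw [h2.tsum_eq] at h4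
  simp only [ENNReal.rpow_two]
  rw [← ofReal_norm, ← ENNReal.ofReal_pow (norm_nonneg _), h4]
  refine tsum_congr fun i => ?_
  rw [← ofReal_norm, ← ENNReal.ofReal_pow (norm_nonneg _)]

lemma tsum_enorm_sq_adjoint {ι κ : Type*} (b : HilbertBasis ι ℂ H) (c : HilbertBasis κ ℂ H)
    (T : H →L[ℂ] H) :
    ∑' i, ‖T (b i)‖ₑ ^ (2 : ℝ) = ∑' j, ‖ContinuousLinearMap.adjoint T (c j)‖ₑ ^ (2 : ℝ) := by
  simp_rw [enorm_sq_eq_tsum c (T _), enorm_sq_eq_tsum b (ContinuousLinearMap.adjoint T _)]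
  rw [ENNReal.tsum_comm]
  refine tsum_congr fun j => tsum_congr fun i => ?_
  rw [ContinuousLinearMap.adjoint_inner_right, ← inner_conj_symm, ← ofReal_norm,
    ← ofReal_norm, RCLike.norm_conj]

/-- The Hilbert-Schmidt norm can be computed in any orthonormal basis. -/
theorem hsNorm_eq_of_basis {ι : Type*} (b : HilbertBasis ι ℂ H) (T : H →L[ℂ] H) :
    hsNorm T = (∑' i, ‖T (b i)‖ₑ ^ (2 : ℝ)) ^ (1 / 2 : ℝ) := by
  rw [hsNorm, tsum_enorm_sq_adjoint (hsBasis H) (hsBasis H), tsum_enorm_sq_adjoint b (hsBasis H)]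

lemma hsNorm_adjoint (T : H →L[ℂ] H) :
    hsNorm (ContinuousLinearMap.adjoint T) = hsNorm T := by
  rw [hsNorm, hsNorm, tsum_enorm_sq_adjoint (hsBasis H) (hsBasis H) T]

lemma hsNorm_zero : hsNorm (0 : H →L[ℂ] H) = 0 := by
  simp [hsNorm]

lemma hsNorm_add_le (S T : H →L[ℂ] H) : hsNorm (S + T) ≤ hsNorm S + hsNorm T := by
  have key : ∀ s : Finset (hsIndex H),
      (∑ i ∈ s, ‖(S + T) (hsBasis H i)‖ₑ ^ (2 : ℝ)) ^ (1 / 2 : ℝ) ≤ hsNorm S + hsNorm T := by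
    intro s
    calc (∑ i ∈ s, ‖(S + T) (hsBasis H i)‖ₑ ^ (2 : ℝ)) ^ (1 / 2 : ℝ)
        ≤ (∑ i ∈ s, (‖S (hsBasis H i)‖ₑ + ‖T (hsBasis H i)‖ₑ) ^ (2 : ℝ)) ^ (1 / 2 : ℝ) := by
          gcongr with i
          exact enorm_add_le _ _
      _ ≤ (∑ i ∈ s, ‖S (hsBasis H i)‖ₑ ^ (2 : ℝ)) ^ (1 / 2 : ℝ)
          + (∑ i ∈ s, ‖T (hsBasis H i)‖ₑ ^ (2 : ℝ)) ^ (1 / 2 : ℝ) :=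
          ENNReal.Lp_add_le s _ _ (by norm_num)
      _ ≤ hsNorm S + hsNorm T := by
          unfold hsNorm
          gcongr <;> exact ENNReal.sum_le_tsum s
  have h2 : ∑' i, ‖(S + T) (hsBasis H i)‖ₑ ^ (2 : ℝ) ≤ (hsNorm S + hsNorm T) ^ (2 : ℝ) := by
    rw [ENNReal.tsum_eq_iSup_sum]
    refine iSup_le fun s => ?_
    have := ENNReal.rpow_le_rpow (key s) (by norm_num : (0 : ℝ) ≤ 2)
    rwa [← ENNReal.rpow_mul, one_div, inv_mul_cancel₀ (by norm_num), ENNReal.rpow_one] at this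
  have := ENNReal.rpow_le_rpow h2 (by norm_num : (0 : ℝ) ≤ 1 / 2)
  rwa [← ENNReal.rpow_mul, one_div, mul_inv_cancel₀ (by norm_num), ENNReal.rpow_one,
    ← one_div] at this

lemma hsNorm_mul_le_left (S T : H →L[ℂ] H) : hsNorm (S * T) ≤ ‖S‖ₑ * hsNorm T := by
  have h : ∑' i, ‖(S * T) (hsBasis H i)‖ₑ ^ (2 : ℝ) ≤
      ‖S‖ₑ ^ (2 : ℝ) * ∑' i, ‖T (hsBasis H i)‖ₑ ^ (2 : ℝ) := by
    rw [← ENNReal.tsum_mul_left]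
    refine ENNReal.tsum_le_tsum fun i => ?_
    rw [← ENNReal.mul_rpow_of_nonneg _ _ (by norm_num)]
    gcongr
    exact S.le_opENorm _
  have := ENNReal.rpow_le_rpow h (by norm_num : (0 : ℝ) ≤ 1 / 2)
  rwa [ENNReal.mul_rpow_of_nonneg _ _ (by norm_num), ← ENNReal.rpow_mul, one_div,
    mul_inv_cancel₀ (by norm_num), ENNReal.rpow_one, ← one_div] at this

lemma hsNorm_mul_le_right (S T : H →L[ℂ] H) : hsNorm (S * T) ≤ hsNorm S * ‖T‖ₑ := by
  have h := hsNorm_mul_le_left (ContinuousLinearMap.adjoint T) (ContinuousLinearMap.adjoint S)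
  have h2 : ContinuousLinearMap.adjoint T * ContinuousLinearMap.adjoint S =
      ContinuousLinearMap.adjoint (S * T) := (ContinuousLinearMap.adjoint_comp S T).symm
  have h3 : ‖ContinuousLinearMap.adjoint T‖ₑ = ‖T‖ₑ := by
    rw [← ofReal_norm, ← ofReal_norm, LinearIsometryEquiv.norm_map]
  rwa [h2, hsNorm_adjoint, hsNorm_adjoint, h3, mul_comm] at h

lemma hsNorm_smul_le (c : ℂ) (T : H →L[ℂ] H) : hsNorm (c • T) ≤ ‖c‖ₑ * hsNorm T := by
  have h := hsNorm_mul_le_left (c • (1 : H →L[ℂ] H)) T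
  rw [smul_mul_assoc, one_mul] at h
  refine h.trans ?_
  gcongr
  rw [enorm_smul]
  calc ‖c‖ₑ * ‖(1 : H →L[ℂ] H)‖ₑ ≤ ‖c‖ₑ * 1 := by
        gcongr
        rw [← ofReal_norm]
        exact ENNReal.ofReal_le_one.2 ContinuousLinearMap.norm_id_le
    _ = ‖c‖ₑ := mul_one _

end HilbertSchmidt

/-- Lebesgue measure on `Ω ⊆ ℂ`. -/
abbrev lebesgueOn (Ω : Set ℂ) : Measure ℂ := (volume : Measure ℂ).restrict Ω

/-- The Hilbert space `L²(Ω, λ)`. -/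
abbrev L2 (Ω : Set ℂ) : Type := Lp ℂ 2 (lebesgueOn Ω)

/-- The algebra `ℬ(L²(Ω, λ))` of bounded operators. -/
abbrev BL2 (Ω : Set ℂ) : Type := L2 Ω →L[ℂ] L2 Ω

/-- The operator `M_f` of multiplication by `f ∈ L^∞(Ω, λ)` on `L²(Ω, λ)`. -/
def mulOp {Ω : Set ℂ} (f : Lp ℂ ∞ (lebesgueOn Ω)) : BL2 Ω :=
  (ContinuousLinearMap.mul ℂ ℂ).holderL (lebesgueOn Ω) ∞ 2 2 f

/-- The difference quotient `Df(s, t) = (f s - f t) / (s - t)`; its value on the diagonal, a null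
set, is irrelevant. -/
def diffQuot (f : ℂ → ℂ) (p : ℂ × ℂ) : ℂ := (f p.1 - f p.2) / (p.1 - p.2)

/-- The essentially Lipschitz functions `Λ(Ω)`: those `f ∈ L^∞(Ω, λ)` with
`Df ∈ L^∞(Ω × Ω, λ ⊗ λ)`. -/
def LambdaSet (Ω : Set ℂ) : Set (Lp ℂ ∞ (lebesgueOn Ω)) :=
  {f | MemLp (diffQuot f) ∞ ((lebesgueOn Ω).prod (lebesgueOn Ω))}

/-- `L(T) = sup {|[M_f, T]|₂ : f ∈ Λ(Ω), ‖Df‖_∞ ≤ 1}`, with values in `[0, ∞]`. -/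
def commL {Ω : Set ℂ} (T : BL2 Ω) : ℝ≥0∞ :=
  ⨆ f ∈ {f ∈ LambdaSet Ω |
    eLpNorm (diffQuot f) ∞ ((lebesgueOn Ω).prod (lebesgueOn Ω)) ≤ 1},
    hsNorm (mulOp f * T - T * mulOp f)

section CommL

variable {Ω : Set ℂ}

lemma commL_zero : commL (0 : BL2 Ω) = 0 := by
  simp [commL, hsNorm_zero]

lemma commL_algebraMap (c : ℂ) : commL (algebraMap ℂ (BL2 Ω) c) = 0 := by
  simp [commL, Algebra.commutes, hsNorm_zero]

lemma commL_add_le (S T : BL2 Ω) : commL (S + T) ≤ commL S + commL T := by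
  refine iSup₂_le fun f hf => ?_
  have e : mulOp f * (S + T) - (S + T) * mulOp f =
      (mulOp f * S - S * mulOp f) + (mulOp f * T - T * mulOp f) := by noncomm_ring
  rw [e]
  refine (hsNorm_add_le _ _).trans (add_le_add ?_ ?_)
  · exact le_iSup₂ (f := fun f _ => hsNorm (mulOp f * S - S * mulOp f)) f hf
  · exact le_iSup₂ (f := fun f _ => hsNorm (mulOp f * T - T * mulOp f)) f hf

lemma commL_smul_le (c : ℂ) (T : BL2 Ω) : commL (c • T) ≤ ‖c‖ₑ * commL T := by
  refine iSup₂_le fun f hf => ?_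
  have e : mulOp f * (c • T) - (c • T) * mulOp f = c • (mulOp f * T - T * mulOp f) := by
    rw [mul_smul_comm, smul_mul_assoc, smul_sub]
  rw [e]
  refine (hsNorm_smul_le _ _).trans ?_
  gcongr
  exact le_iSup₂ (f := fun f _ => hsNorm (mulOp f * T - T * mulOp f)) f hf

lemma commL_neg (T : BL2 Ω) : commL (-T) = commL T := by
  have h : ∀ S : BL2 Ω, commL (-S) ≤ commL S := fun S => by
    simpa using commL_smul_le (-1) S
  exact le_antisymm (h T) (by simpa using h (-T))

lemma commL_mul_le (S T : BL2 Ω) : commL (S * T) ≤ commL S * ‖T‖ₑ + ‖S‖ₑ * commL T := by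
  refine iSup₂_le fun f hf => ?_
  have e : mulOp f * (S * T) - (S * T) * mulOp f =
      (mulOp f * S - S * mulOp f) * T + S * (mulOp f * T - T * mulOp f) := by noncomm_ring
  rw [e]
  refine (hsNorm_add_le _ _).trans (add_le_add ?_ ?_)
  · refine (hsNorm_mul_le_right _ _).trans ?_
    gcongr
    exact le_iSup₂ (f := fun f _ => hsNorm (mulOp f * S - S * mulOp f)) f hf
  · refine (hsNorm_mul_le_left _ _).trans ?_
    gcongr
    exact le_iSup₂ (f := fun f _ => hsNorm (mulOp f * T - T * mulOp f)) f hf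

end CommL

/-- The algebra `EΛ(Ω) = {T ∈ ℬ(L²(Ω, λ)) : L(T) < ∞}`. -/
def ELambda (Ω : Set ℂ) : Subalgebra ℂ (BL2 Ω) where
  carrier := {T | commL T < ∞}
  mul_mem' {S T} hS hT := by
    simp only [Set.mem_ofPred_eq] at hS hT ⊢
    exact (commL_mul_le S T).trans_lt (ENNReal.add_lt_top.2
      ⟨ENNReal.mul_lt_top hS enorm_lt_top, ENNReal.mul_lt_top enorm_lt_top hT⟩)
  add_mem' {S T} hS hT := (commL_add_le S T).trans_lt (ENNReal.add_lt_top.2 ⟨hS, hT⟩)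
  algebraMap_mem' c := by simp [commL_algebraMap]

/-- The compact operators in `EΛ(Ω)`, as a subalgebra of `ℬ(L²(Ω, λ))`. -/
def KLambdaSub (Ω : Set ℂ) : NonUnitalSubalgebra ℂ (BL2 Ω) where
  carrier := {T | T ∈ ELambda Ω ∧ IsCompactOperator T}
  mul_mem' {_ T} hS hT := ⟨mul_mem hS.1 hT.1, hS.2.comp_clm T⟩
  add_mem' {_ _} hS hT := ⟨add_mem hS.1 hT.1, hS.2.add hT.2⟩
  zero_mem' := ⟨zero_mem _, isCompactOperator_zero⟩
  smul_mem' c _ hT := ⟨(ELambda Ω).smul_mem hT.1 c, hT.2.smul c⟩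

/-- The algebra `𝒦Λ(Ω)` of compact operators in `EΛ(Ω)`. As a type of its own, since it carries
the norm `‖T‖ + L(T)` and not the operator norm. -/
def KLambda (Ω : Set ℂ) : Type := KLambdaSub Ω

namespace KLambda

variable {Ω : Set ℂ}

instance : NonUnitalRing (KLambda Ω) := inferInstanceAs (NonUnitalRing (KLambdaSub Ω))

instance : Module ℂ (KLambda Ω) := inferInstanceAs (Module ℂ (KLambdaSub Ω))

instance : SMulCommClass ℂ (KLambda Ω) (KLambda Ω) :=
  inferInstanceAs (SMulCommClass ℂ (KLambdaSub Ω) (KLambdaSub Ω))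

instance : IsScalarTower ℂ (KLambda Ω) (KLambda Ω) :=
  inferInstanceAs (IsScalarTower ℂ (KLambdaSub Ω) (KLambdaSub Ω))

/-- The operator underlying an element of `𝒦Λ(Ω)`. -/
def toOp (x : KLambda Ω) : BL2 Ω := Subtype.val x

lemma toOp_mem (x : KLambda Ω) : x.toOp ∈ ELambda Ω := (Subtype.property x).1

lemma toOp_compact (x : KLambda Ω) : IsCompactOperator x.toOp := (Subtype.property x).2

lemma toOp_injective : Function.Injective (toOp : KLambda Ω → BL2 Ω) := Subtype.val_injective

lemma toOp_zero : (0 : KLambda Ω).toOp = 0 := rfl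

lemma toOp_add (x y : KLambda Ω) : (x + y).toOp = x.toOp + y.toOp := rfl

lemma toOp_neg (x : KLambda Ω) : (-x).toOp = -x.toOp := rfl

lemma toOp_smul (c : ℂ) (x : KLambda Ω) : (c • x).toOp = c • x.toOp := rfl

lemma toOp_mul (x y : KLambda Ω) : (x * y).toOp = x.toOp * y.toOp := rfl

lemma commL_ne_top (x : KLambda Ω) : commL x.toOp ≠ ∞ := (x.toOp_mem : commL x.toOp < ∞).ne

/-- The norm `⦀x⦀ = ‖x‖ + L(x)`. -/
instance : Norm (KLambda Ω) := ⟨fun x => ‖x.toOp‖ + (commL x.toOp).toReal⟩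

lemma norm_def (x : KLambda Ω) : ‖x‖ = ‖x.toOp‖ + (commL x.toOp).toReal := rfl

/-- The norm `⦀·⦀` as a group norm. -/
def addGroupNorm (Ω : Set ℂ) : AddGroupNorm (KLambda Ω) where
  toFun x := ‖x‖
  map_zero' := by simp [norm_def, toOp_zero, commL_zero]
  add_le' x y := by
    have h : (commL (x.toOp + y.toOp)).toReal ≤ (commL x.toOp).toReal + (commL y.toOp).toReal := by
      rw [← ENNReal.toReal_add x.commL_ne_top y.commL_ne_top]
      exact ENNReal.toReal_mono (ENNReal.add_ne_top.2 ⟨x.commL_ne_top, y.commL_ne_top⟩)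
        (commL_add_le _ _)
    have h2 := norm_add_le x.toOp y.toOp
    simp only [norm_def, toOp_add]
    linarith
  neg' x := by simp [norm_def, toOp_neg, commL_neg]
  eq_zero_of_map_eq_zero' x hx := by
    have h1 := norm_nonneg x.toOp
    have h2 : 0 ≤ (commL x.toOp).toReal := ENNReal.toReal_nonneg
    rw [norm_def] at hx
    exact toOp_injective (norm_eq_zero.1 (by linarith))

lemma norm_mul_le_mul_norm (x y : KLambda Ω) : ‖x * y‖ ≤ ‖x‖ * ‖y‖ := by
  have h : (commL (x.toOp * y.toOp)).toReal ≤
      (commL x.toOp).toReal * ‖y.toOp‖ + ‖x.toOp‖ * (commL y.toOp).toReal := by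
    have e : (commL x.toOp * ‖y.toOp‖ₑ + ‖x.toOp‖ₑ * commL y.toOp).toReal =
        (commL x.toOp).toReal * ‖y.toOp‖ + ‖x.toOp‖ * (commL y.toOp).toReal := by
      rw [ENNReal.toReal_add (ENNReal.mul_ne_top x.commL_ne_top enorm_ne_top)
        (ENNReal.mul_ne_top enorm_ne_top y.commL_ne_top), ENNReal.toReal_mul, ENNReal.toReal_mul,
        toReal_enorm, toReal_enorm]
    rw [← e]
    exact ENNReal.toReal_mono (ENNReal.add_ne_top.2
      ⟨ENNReal.mul_ne_top x.commL_ne_top enorm_ne_top,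
        ENNReal.mul_ne_top enorm_ne_top y.commL_ne_top⟩) (commL_mul_le _ _)
  have h2 := norm_mul_le x.toOp y.toOp
  have h3 : 0 ≤ (commL x.toOp).toReal * (commL y.toOp).toReal :=
    mul_nonneg ENNReal.toReal_nonneg ENNReal.toReal_nonneg
  simp only [norm_def, toOp_mul]
  nlinarith

instance : NonUnitalNormedRing (KLambda Ω) :=
  { (inferInstance : NonUnitalRing (KLambda Ω)),
    (addGroupNorm Ω).toNormedAddCommGroup with
    norm_mul_le := norm_mul_le_mul_norm }

instance : NormedSpace ℂ (KLambda Ω) where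
  norm_smul_le c x := by
    have h : (commL (c • x.toOp)).toReal ≤ ‖c‖ * (commL x.toOp).toReal := by
      have := ENNReal.toReal_mono (ENNReal.mul_ne_top enorm_ne_top x.commL_ne_top)
        (commL_smul_le c x.toOp)
      rwa [ENNReal.toReal_mul, toReal_enorm] at this
    change ‖c • x.toOp‖ + (commL (c • x.toOp)).toReal ≤
      ‖c‖ * (‖x.toOp‖ + (commL x.toOp).toReal)
    rw [norm_smul]
    linarith

end KLambda

end

/-!
The double centralizers of `𝒦Λ(Ω)` are determined by an approximate unit `e_N` which is bounded for
`⦀·⦀` and converges strongly to `1`: given `(T', T'')`, the bounded operators `T''(e_N)*` converge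
strongly, by `T'(x) e_N = x T''(e_N)`, and `T` is the adjoint of their limit. As `T''(e_N) = T e_N`
then converges strongly to `T`, lower semicontinuity of `L` gives `L(T) < ∞`.

The conditional expectation onto the dyadic squares of side `2⁻ᵏ` in `[-N, N) × [-N, N)` is a
projection `P` of rank about `4 N² 4ᵏ`, and `L(P)²` is bounded by the maximum of `|s - t|²` on a
square times the rank, hence by a multiple of `N²` that does not depend on `k`. For the mean of the
projections of `M` consecutive scales this improves by a factor `M`: in the product of the kernels
at scales `j ≤ l` the finer one gives the factor `4⁻ˡ` and the coarser one the factor `4ʲ`, so the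
scales are almost orthogonal, and the square of `L` of the sum of the projections grows only
linearly in `M`. Taking `M = N²` makes `L(e_N)` bounded.
-/

section HilbertSchmidt

variable {H : Type*} [NormedAddCommGroup H] [InnerProductSpace ℂ H] [CompleteSpace H]

lemma hsNorm_sq (T : H →L[ℂ] H) : hsNorm T ^ 2 = ∑' i, ‖T (hsBasis H i)‖ₑ ^ 2 := by
  rw [hsNorm, ← ENNReal.rpow_two, ← ENNReal.rpow_mul, one_div, inv_mul_cancel₀ two_ne_zero,
    ENNReal.rpow_one]
  simp only [ENNReal.rpow_two]

open Filter Topology in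
lemma hsNorm_le_of_tendsto {α : Type*} {l : Filter α} [l.NeBot] {T : H →L[ℂ] H}
    {S : α → H →L[ℂ] H} {C : ℝ≥0∞} (hS : ∀ v, Tendsto (fun a => S a v) l (𝓝 (T v)))
    (hC : ∀ a, hsNorm (S a) ≤ C) : hsNorm T ≤ C := by
  rw [← ENNReal.pow_le_pow_left_iff two_ne_zero, hsNorm_sq, ENNReal.tsum_eq_iSup_sum]
  refine iSup_le fun F => ?_
  have hlim : Tendsto (fun a => ∑ i ∈ F, ‖S a (hsBasis H i)‖ₑ ^ 2) l
      (𝓝 (∑ i ∈ F, ‖T (hsBasis H i)‖ₑ ^ 2)) :=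
    tendsto_finsetSum _ fun i _ =>
      ((ENNReal.continuous_pow 2).comp continuous_enorm).tendsto _ |>.comp (hS _)
  refine le_of_tendsto' hlim fun a => ?_
  calc ∑ i ∈ F, ‖S a (hsBasis H i)‖ₑ ^ 2 ≤ ∑' i, ‖S a (hsBasis H i)‖ₑ ^ 2 :=
        ENNReal.sum_le_tsum F
    _ = hsNorm (S a) ^ 2 := (hsNorm_sq _).symm
    _ ≤ C ^ 2 := by gcongr; exact hC a

end HilbertSchmidt

section IntegralKernel

open InnerProductSpace
open scoped ComplexConjugate

variable {X : Type*} [MeasurableSpace X] {μ : Measure X}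

lemma enorm_sq_eq_lintegral (h : Lp ℂ 2 μ) : ‖h‖ₑ ^ 2 = ∫⁻ s, ‖h s‖ₑ ^ 2 ∂μ := by
  have key := eLpNorm_nnreal_pow_eq_lintegral (f := h) (μ := μ) (p := 2) two_ne_zero
  rw [Lp.enorm_def]
  simpa only [NNReal.coe_ofNat, ENNReal.coe_ofNat, ENNReal.rpow_two] using key

/-- The operator `T` on `L²(μ)` is the integral operator with kernel `k`, all of whose sections
`k s` are required to be square integrable, so that the integral defining `T h s` converges. -/
structure HasIntegralKernel (T : Lp ℂ 2 μ →L[ℂ] Lp ℂ 2 μ) (k : X → X → ℂ) : Prop where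
  memLp : ∀ s, MemLp (k s) 2 μ
  ae_apply : ∀ h : Lp ℂ 2 μ, ∀ᵐ s ∂μ, T h s = ∫ t, k s t * h t ∂μ

namespace HasIntegralKernel

lemma integrable_mul {T : Lp ℂ 2 μ →L[ℂ] Lp ℂ 2 μ} {k : X → X → ℂ} (hT : HasIntegralKernel T k)
    (s : X) (h : Lp ℂ 2 μ) : Integrable (fun t => k s t * h t) μ :=
  MemLp.integrable_mul (hT.memLp s) (Lp.memLp h)

lemma const_smul {T : Lp ℂ 2 μ →L[ℂ] Lp ℂ 2 μ} {k : X → X → ℂ} (hT : HasIntegralKernel T k)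
    (c : ℂ) : HasIntegralKernel (c • T) fun s t => c * k s t where
  memLp s := (hT.memLp s).const_mul c
  ae_apply h := by
    filter_upwards [Lp.coeFn_smul c (T h), hT.ae_apply h] with s hsmul hTs
    simp only [smul_apply, hsmul, Pi.smul_apply, hTs, smul_eq_mul, mul_assoc,
      integral_const_mul]

lemma sum {α : Type*} {F : Finset α} {T : α → Lp ℂ 2 μ →L[ℂ] Lp ℂ 2 μ} {k : α → X → X → ℂ}
    (hT : ∀ a ∈ F, HasIntegralKernel (T a) (k a)) :
    HasIntegralKernel (∑ a ∈ F, T a) fun s t => ∑ a ∈ F, k a s t where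
  memLp s := memLp_finsetSum F fun a ha => (hT a ha).memLp s
  ae_apply h := by
    have hF : ∀ᵐ s ∂μ, ∀ a ∈ F, T a h s = ∫ t, k a s t * h t ∂μ :=
      (Finset.eventually_all F).2 fun a ha => (hT a ha).ae_apply h
    filter_upwards [Lp.coeFn_finsetSum F fun a => T a h, hF] with s hsum hs
    simp only [sum_apply, hsum, Finset.sum_apply, Finset.sum_mul]
    rw [integral_finsetSum F fun a ha => (hT a ha).integrable_mul s h]
    exact Finset.sum_congr rfl hs

lemma rankOne {a b : X → ℂ} (ha : MemLp a 2 μ) (hb : MemLp b 2 μ) :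
    HasIntegralKernel (rankOne ℂ (ha.toLp a) (hb.toLp b)) fun s t => a s * conj (b t) where
  memLp s := hb.star.const_mul (a s)
  ae_apply h := by
    filter_upwards [Lp.coeFn_smul (inner ℂ (hb.toLp b) h) (ha.toLp a), ha.coeFn_toLp]
      with s hsmul has
    rw [rankOne_apply, hsmul, Pi.smul_apply, has, smul_eq_mul, mul_comm, L2.inner_def,
      ← integral_const_mul]
    refine integral_congr_ae ?_
    filter_upwards [hb.coeFn_toLp] with t hbt
    rw [hbt, RCLike.inner_apply', mul_assoc]

/-- Each value `T h s` is an inner product with `k s`; Bessel's inequality then bounds the sum over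
an orthonormal basis under the integral. -/
lemma hsNorm_sq_le {T : Lp ℂ 2 μ →L[ℂ] Lp ℂ 2 μ} {k : X → X → ℂ} (hT : HasIntegralKernel T k) :
    hsNorm T ^ 2 ≤ ∫⁻ s, ∫⁻ t, ‖k s t‖ₑ ^ 2 ∂μ ∂μ := by
  let G (s : X) : Lp ℂ 2 μ := (hT.memLp s).star.toLp
  have hG_coe (s : X) : G s =ᵐ[μ] fun t => conj (k s t) := MemLp.coeFn_toLp _
  have hG_inner (h : Lp ℂ 2 μ) : ∀ᵐ s ∂μ, T h s = inner ℂ (G s) h := by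
    filter_upwards [hT.ae_apply h] with s hs
    rw [hs, L2.inner_def]
    refine integral_congr_ae ?_
    filter_upwards [hG_coe s] with t ht
    rw [ht, RCLike.inner_apply', Complex.conj_conj]
  have hG_norm (s : X) : ‖G s‖ₑ ^ 2 = ∫⁻ t, ‖k s t‖ₑ ^ 2 ∂μ := by
    rw [enorm_sq_eq_lintegral]
    refine lintegral_congr_ae ?_
    filter_upwards [hG_coe s] with t ht
    rw [ht, RCLike.enorm_conj]
  simp only [← hG_norm]
  rw [hsNorm_sq, ENNReal.tsum_eq_iSup_sum]
  refine iSup_le fun F => ?_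
  simp only [enorm_sq_eq_lintegral (T _)]
  rw [← lintegral_finsetSum' _ fun i _ => (Lp.aestronglyMeasurable _).enorm.pow_const _]
  refine lintegral_mono_ae ?_
  filter_upwards [(Finset.eventually_all F).2 fun i _ => hG_inner (hsBasis _ i)] with s hs
  calc ∑ i ∈ F, ‖T (hsBasis _ i) s‖ₑ ^ 2 = ∑ i ∈ F, ‖inner ℂ (hsBasis _ i) (G s)‖ₑ ^ 2 := by
        refine Finset.sum_congr rfl fun i hi => ?_
        rw [hs i hi, ← inner_conj_symm, RCLike.enorm_conj]
    _ ≤ ∑' i, ‖inner ℂ (hsBasis _ i) (G s)‖ₑ ^ 2 := ENNReal.sum_le_tsum F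
    _ = ‖G s‖ₑ ^ 2 := by
        simpa only [ENNReal.rpow_two] using (enorm_sq_eq_tsum (hsBasis (Lp ℂ 2 μ)) (G s)).symm

end HasIntegralKernel

end IntegralKernel

section CommL

variable {Ω : Set ℂ}

open Filter Topology in
lemma commL_le_of_tendsto {α : Type*} {l : Filter α} [l.NeBot] {T : BL2 Ω} {S : α → BL2 Ω}
    {C : ℝ≥0∞} (hS : ∀ v, Tendsto (fun a => S a v) l (𝓝 (T v))) (hC : ∀ a, commL (S a) ≤ C) :
    commL T ≤ C :=
  iSup₂_le fun f hf => hsNorm_le_of_tendsto (S := fun a => mulOp f * S a - S a * mulOp f)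
    (fun v => (((mulOp f).continuous.tendsto _).comp (hS v)).sub (hS _))
    fun a => (le_iSup₂ (f := fun f _ => hsNorm (mulOp f * S a - S a * mulOp f)) f hf).trans (hC a)

lemma coeFn_mulOp (f : Lp ℂ ∞ (lebesgueOn Ω)) (h : L2 Ω) :
    mulOp f h =ᵐ[lebesgueOn Ω] fun s => f s * h s :=
  (ContinuousLinearMap.mul ℂ ℂ).coeFn_holder f h

lemma HasIntegralKernel.commutator_mulOp {T : BL2 Ω} {k : ℂ → ℂ → ℂ} (hT : HasIntegralKernel T k)
    (f : Lp ℂ ∞ (lebesgueOn Ω)) :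
    HasIntegralKernel (mulOp f * T - T * mulOp f) fun s t => (f s - f t) * k s t where
  memLp s := (hT.memLp s).mul ((memLp_top_const (f s)).sub (Lp.memLp f))
  ae_apply h := by
    filter_upwards [Lp.coeFn_sub (mulOp f (T h)) (T (mulOp f h)), coeFn_mulOp f (T h),
      hT.ae_apply h, hT.ae_apply (mulOp f h)] with s hsub hmul hTh hTfh
    change (mulOp f (T h) - T (mulOp f h) : L2 Ω) s = _
    rw [hsub, Pi.sub_apply, hmul, hTh, hTfh, ← integral_const_mul, ← integral_sub
      ((hT.integrable_mul s h).const_mul _) (hT.integrable_mul s (mulOp f h))]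
    refine integral_congr_ae ?_
    filter_upwards [coeFn_mulOp f h] with t ht
    rw [ht]
    ring

lemma ae_enorm_sub_le_of_eLpNorm_diffQuot_le_one {μ : Measure ℂ} [SFinite μ] {f : ℂ → ℂ}
    (hf : eLpNorm (diffQuot f) ∞ (μ.prod μ) ≤ 1) :
    ∀ᵐ s ∂μ, ∀ᵐ t ∂μ, ‖f s - f t‖ₑ ≤ ‖s - t‖ₑ := by
  have hquot : ∀ᵐ p ∂(μ.prod μ), ‖diffQuot f p‖ₑ ≤ 1 := by
    rw [eLpNorm_exponent_top] at hf
    filter_upwards [ae_le_eLpNormEssSup (f := diffQuot f) (μ := μ.prod μ)] with p hp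
      using hp.trans hf
  filter_upwards [Measure.ae_ae_of_ae_prod hquot] with s hs
  filter_upwards [hs] with t ht
  rcases eq_or_ne s t with rfl | hne
  · simp
  · have hmul : f s - f t = diffQuot f (s, t) * (s - t) :=
      (div_mul_cancel₀ _ (sub_ne_zero.2 hne)).symm
    rw [hmul, enorm_mul]
    exact mul_le_of_le_one_left' ht

lemma HasIntegralKernel.commL_sq_le {T : BL2 Ω} {k : ℂ → ℂ → ℂ} (hT : HasIntegralKernel T k) :
    commL T ^ 2 ≤ ∫⁻ s, ∫⁻ t, ‖s - t‖ₑ ^ 2 * ‖k s t‖ₑ ^ 2 ∂(lebesgueOn Ω) ∂(lebesgueOn Ω) := by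
  simp only [commL, ENNReal.iSup_pow_of_ne_zero two_ne_zero]
  refine iSup₂_le fun f hf => (hT.commutator_mulOp f).hsNorm_sq_le.trans (lintegral_mono_ae ?_)
  filter_upwards [ae_enorm_sub_le_of_eLpNorm_diffQuot_le_one hf.2] with s hs
  refine lintegral_mono_ae ?_
  filter_upwards [hs] with t ht
  rw [enorm_mul, mul_pow]
  gcongr

end CommL

section OrthogonalFamily

open InnerProductSpace Submodule

variable {𝕜 E : Type*} [RCLike 𝕜] [NormedAddCommGroup E] [InnerProductSpace 𝕜 E]

lemma isCompactOperator_starProjection (K : Submodule 𝕜 E) [FiniteDimensional 𝕜 K] :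
    IsCompactOperator K.starProjection :=
  haveI := FiniteDimensional.proper_rclike 𝕜 K
  (isCompactOperator_of_locallyCompactSpace_rng K.subtypeL).comp_clm K.orthogonalProjectionOnto

variable {ι : Type*} {v : ι → E}

instance finiteDimensional_span_image_finset (v : ι → E) (F : Finset ι) :
    FiniteDimensional 𝕜 (span 𝕜 (v '' F)) :=
  FiniteDimensional.span_of_finite 𝕜 (F.finite_toSet.image v)

/-- The `v i` may vanish: the coefficient of such a term is `0⁻¹ = 0`. -/
lemma starProjection_span_image_eq_sum_rankOne (hv : Pairwise fun i j => inner 𝕜 (v i) (v j) = 0)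
    (F : Finset ι) :
    (span 𝕜 (v '' F)).starProjection =
      ∑ i ∈ F, ((‖v i‖ : 𝕜) ^ 2)⁻¹ • rankOne 𝕜 (v i) (v i) := by
  ext x
  simp only [sum_apply, smul_apply, rankOne_apply]
  have hmem {i : ι} (hi : i ∈ F) : v i ∈ span 𝕜 (v '' F) := subset_span ⟨i, hi, rfl⟩
  refine eq_starProjection_of_mem_of_inner_eq_zero ?_ fun w hw => ?_
  · exact sum_mem fun i hi => smul_mem _ _ (smul_mem _ _ (hmem hi))
  induction hw using span_induction with
  | mem w hw =>
    obtain ⟨j, hj, rfl⟩ := hw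
    rw [inner_sub_left, sum_inner, Finset.sum_eq_single_of_mem j hj fun i _ hij => by
      rw [inner_smul_left, inner_smul_left, hv hij, mul_zero, mul_zero]]
    rcases eq_or_ne (v j) 0 with hj0 | hj0
    · simp [hj0]
    · have : (‖v j‖ : 𝕜) ≠ 0 := by simpa using hj0
      rw [inner_smul_left, inner_smul_left, inner_self_eq_norm_sq_to_K, inner_conj_symm, map_inv₀,
        map_pow, RCLike.conj_ofReal]
      field_simp
      ring
  | zero => exact inner_zero_right _
  | add _ _ _ _ h₁ h₂ => rw [inner_add_right, h₁, h₂, add_zero]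
  | smul c _ _ h => rw [inner_smul_right, h, mul_zero]

end OrthogonalFamily

section CellProjection

open InnerProductSpace Submodule

variable {X ι : Type*} [MeasurableSpace X] {μ : Measure X} {q : X → ι}

/-- The map `q` cuts the space into cells, its fibres, which are required to be measurable of finite
measure. -/
structure FiniteMeasureFibers (μ : Measure X) (q : X → ι) : Prop where
  measurableSet (i : ι) : MeasurableSet (q ⁻¹' {i})
  measure_ne_top (i : ι) : μ (q ⁻¹' {i}) ≠ ∞

open Classical in
/-- The kernel of averaging over the cells with index in `F`: it vanishes unless `s` and `t` lie in
the same cell of index in `F`, and then it is the inverse of the measure of that cell. This is a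
real inverse, so it is `0` if the cell is a null set or has infinite measure. -/
noncomputable def cellKernel (μ : Measure X) (q : X → ι) (F : Finset ι) (s t : X) : ℂ :=
  if q s ∈ F ∧ q t = q s then (μ.real (q ⁻¹' {q s}) : ℂ)⁻¹ else 0

/-- The inverse of the measure of the cell of `s`, if its index is in `F`. -/
noncomputable def cellDensity (μ : Measure X) (q : X → ι) (F : Finset ι) (s : X) : ℝ≥0∞ :=
  ∑ i ∈ F, (q ⁻¹' {i}).indicator (fun _ => (μ (q ⁻¹' {i}))⁻¹) s

lemma cellKernel_eq_zero {F : Finset ι} {s t : X} (hst : q s ≠ q t) :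
    cellKernel μ q F s t = 0 :=
  if_neg fun h => hst h.2.symm

namespace FiniteMeasureFibers

/-- The indicator function of the cell with index `i`, as a vector of `L²(μ)`. -/
noncomputable def cellVec (hq : FiniteMeasureFibers μ q) (i : ι) : Lp ℂ 2 μ :=
  indicatorConstLp 2 (hq.measurableSet i) (hq.measure_ne_top i) 1

/-- The conditional expectation onto the functions which are constant on each cell with index in
`F` and vanish outside these cells. -/
noncomputable def cellProj (hq : FiniteMeasureFibers μ q) (F : Finset ι) :
    Lp ℂ 2 μ →L[ℂ] Lp ℂ 2 μ :=
  (span ℂ (hq.cellVec '' F)).starProjection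

variable (hq : FiniteMeasureFibers μ q) (F : Finset ι)

lemma norm_cellProj_le : ‖hq.cellProj F‖ ≤ 1 := starProjection_norm_le _

lemma isSelfAdjoint_cellProj : IsSelfAdjoint (hq.cellProj F) := isSelfAdjoint_starProjection _

lemma isCompactOperator_cellProj : IsCompactOperator (hq.cellProj F) :=
  isCompactOperator_starProjection _

lemma pairwise_inner_cellVec :
    Pairwise fun i j => inner ℂ (hq.cellVec i) (hq.cellVec j) = 0 := fun i j hij => by
  have hdisj : Disjoint (q ⁻¹' {i}) (q ⁻¹' {j}) :=
    Disjoint.preimage q (Set.disjoint_singleton.2 hij)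
  simp only [cellVec]
  rw [L2.inner_indicatorConstLp_one_indicatorConstLp_one _ _ (hq.measure_ne_top i)
      (hq.measure_ne_top j), hdisj.inter_eq, measureReal_empty, RCLike.ofReal_zero]

lemma norm_cellVec_sq (i : ι) : ‖hq.cellVec i‖ ^ 2 = μ.real (q ⁻¹' {i}) := by
  rw [← inner_self_eq_norm_sq (𝕜 := ℂ), cellVec,
    L2.inner_indicatorConstLp_one_indicatorConstLp_one _ _ (hq.measure_ne_top i)
      (hq.measure_ne_top i), Set.inter_self, RCLike.ofReal_re]

lemma coeFn_cellVec (i : ι) :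
    hq.cellVec i =ᵐ[μ] (q ⁻¹' {i}).indicator fun _ => 1 := indicatorConstLp_coeFn

lemma hasIntegralKernel_cellProj : HasIntegralKernel (hq.cellProj F) (cellKernel μ q F) := by
  have hmem (i : ι) : MemLp ((q ⁻¹' {i}).indicator fun _ => (1 : ℂ)) 2 μ :=
    memLp_indicator_const 2 (hq.measurableSet i) 1 (Or.inr (hq.measure_ne_top i))
  convert HasIntegralKernel.sum (F := F) fun i _ =>
    (HasIntegralKernel.rankOne (hmem i) (hmem i)).const_smul ((‖hq.cellVec i‖ : ℂ) ^ 2)⁻¹ using 1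
  · exact starProjection_span_image_eq_sum_rankOne hq.pairwise_inner_cellVec F
  · funext s t
    simp only [cellKernel, ← Complex.ofReal_pow, hq.norm_cellVec_sq]
    by_cases hs : q s ∈ F
    · rw [Finset.sum_eq_single_of_mem _ hs fun i _ hi => by simp [hi.symm]]
      by_cases ht : q t = q s <;> simp [hs, ht]
    · rw [Finset.sum_eq_zero fun i hi => by
        rw [Set.indicator_of_notMem (s := q ⁻¹' {i}) fun h : q s = i => hs (h.symm ▸ hi),
          zero_mul, mul_zero],
        if_neg fun h => hs h.1]

end FiniteMeasureFibers

end CellProjection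

section CellKernel

variable {X ι : Type*} [MeasurableSpace X] {μ : Measure X} {q : X → ι}

lemma enorm_cellKernel_le (F : Finset ι) (s t : X) :
    ‖cellKernel μ q F s t‖ₑ ≤ (q ⁻¹' {q s}).indicator (fun _ => (μ (q ⁻¹' {q s}))⁻¹) t := by
  by_cases hst : q t = q s
  · rw [Set.indicator_of_mem (s := q ⁻¹' {q s}) hst, cellKernel]
    split_ifs
    · rw [measureReal_def]
      rcases eq_or_ne (μ (q ⁻¹' {q s})) 0 with h0 | h0
      · simp [h0]
      rcases eq_or_ne (μ (q ⁻¹' {q s})) ∞ with htop | htop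
      · simp [htop]
      · rw [enorm_inv (Complex.ofReal_ne_zero.2 (ENNReal.toReal_ne_zero.2 ⟨h0, htop⟩)),
          ← ofReal_norm, Complex.norm_real, ofReal_norm, Real.enorm_toReal htop]
    · exact enorm_zero.trans_le zero_le
  · rw [cellKernel_eq_zero (Ne.symm hst), enorm_zero]
    exact zero_le

lemma enorm_cellKernel_le_cellDensity (F : Finset ι) (s t : X) :
    ‖cellKernel μ q F s t‖ₑ ≤ cellDensity μ q F s := by
  by_cases hs : q s ∈ F
  · calc ‖cellKernel μ q F s t‖ₑ ≤ (μ (q ⁻¹' {q s}))⁻¹ :=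
          (enorm_cellKernel_le F s t).trans (Set.indicator_le_self' (fun _ _ => zero_le) t)
      _ = (q ⁻¹' {q s}).indicator (fun _ => (μ (q ⁻¹' {q s}))⁻¹) s := by
          rw [Set.indicator_of_mem (s := q ⁻¹' {q s}) rfl]
      _ ≤ cellDensity μ q F s := Finset.single_le_sum
          (f := fun i => (q ⁻¹' {i}).indicator (fun _ => (μ (q ⁻¹' {i}))⁻¹) s)
          (fun _ _ => zero_le) hs
  · rw [cellKernel, if_neg fun h => hs h.1, enorm_zero]
    exact zero_le

lemma lintegral_enorm_cellKernel_le_one (F : Finset ι) (s : X) :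
    ∫⁻ t, ‖cellKernel μ q F s t‖ₑ ∂μ ≤ 1 :=
  calc ∫⁻ t, ‖cellKernel μ q F s t‖ₑ ∂μ
      ≤ ∫⁻ t, (q ⁻¹' {q s}).indicator (fun _ => (μ (q ⁻¹' {q s}))⁻¹) t ∂μ :=
        lintegral_mono (enorm_cellKernel_le F s)
    _ ≤ (μ (q ⁻¹' {q s}))⁻¹ * μ (q ⁻¹' {q s}) := lintegral_indicator_const_le _ _
    _ ≤ 1 := ENNReal.inv_mul_le_one _

lemma measurable_cellDensity {F : Finset ι} (hq : ∀ i ∈ F, MeasurableSet (q ⁻¹' {i})) :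
    Measurable (cellDensity μ q F) :=
  Finset.measurable_fun_sum F fun i hi => measurable_const.indicator (hq i hi)

lemma lintegral_cellDensity_le_card {F : Finset ι} (hq : ∀ i ∈ F, MeasurableSet (q ⁻¹' {i})) :
    ∫⁻ s, cellDensity μ q F s ∂μ ≤ F.card :=
  calc ∫⁻ s, cellDensity μ q F s ∂μ
      = ∑ i ∈ F, ∫⁻ s, (q ⁻¹' {i}).indicator (fun _ => (μ (q ⁻¹' {i}))⁻¹) s ∂μ :=
        lintegral_finsetSum' F fun i hi => (measurable_const.indicator (hq i hi)).aemeasurable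
    _ ≤ ∑ _i ∈ F, 1 := Finset.sum_le_sum fun i _ =>
        (lintegral_indicator_const_le _ _).trans (ENNReal.inv_mul_le_one _)
    _ = F.card := by simp

end CellKernel

section Multiscale

lemma sum_range_sq_le {R : Type*} [CommSemiring R] [PartialOrder R] [IsOrderedRing R]
    [CanonicallyOrderedAdd R] (x : ℕ → R) (M : ℕ) :
    (∑ j ∈ Finset.range M, x j) ^ 2 ≤
      2 * ∑ l ∈ Finset.range M, ∑ j ∈ Finset.range (l + 1), x j * x l := by
  induction M with
  | zero => simp
  | succ M ih =>
    rw [Finset.sum_range_succ, Finset.sum_range_succ]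
    calc (∑ j ∈ Finset.range M, x j + x M) ^ 2
        = (∑ j ∈ Finset.range M, x j) ^ 2 + 2 * ((∑ j ∈ Finset.range M, x j) * x M)
            + x M * x M := by ring
      _ ≤ (2 * ∑ l ∈ Finset.range M, ∑ j ∈ Finset.range (l + 1), x j * x l)
            + 2 * ((∑ j ∈ Finset.range M, x j) * x M) + 2 * (x M * x M) :=
          add_le_add (add_le_add_left ih _) (le_self_add.trans_eq (two_mul _).symm)
      _ = _ := by rw [Finset.sum_range_succ _ M, Finset.sum_mul]; ring

variable {X ι : Type*} [MeasurableSpace X] {μ : Measure X} {q : ℕ → X → ι} {ρ : X → X → ℝ≥0∞}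
  {δ : ℕ → ℝ≥0∞}

/-- In a product of two kernels only the finer one restricts the distance of `s` and `t`. It is kept
since it integrates to at most `1` in `t`; the coarser one is bounded by its density. -/
lemma mul_enorm_sum_cellKernel_sq_le (hρ : ∀ l s t, q l s = q l t → ρ s t ≤ δ l)
    (F : ℕ → Finset ι) (M : ℕ) (s t : X) :
    ρ s t * ‖∑ j ∈ Finset.range M, cellKernel μ (q j) (F j) s t‖ₑ ^ 2 ≤
      2 * ∑ l ∈ Finset.range M, ∑ j ∈ Finset.range (l + 1),
        δ l * cellDensity μ (q j) (F j) s * ‖cellKernel μ (q l) (F l) s t‖ₑ := by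
  calc ρ s t * ‖∑ j ∈ Finset.range M, cellKernel μ (q j) (F j) s t‖ₑ ^ 2
      ≤ ρ s t * (2 * ∑ l ∈ Finset.range M, ∑ j ∈ Finset.range (l + 1),
          ‖cellKernel μ (q j) (F j) s t‖ₑ * ‖cellKernel μ (q l) (F l) s t‖ₑ) := by
        grw [enorm_sum_le, sum_range_sq_le]
    _ = 2 * ∑ l ∈ Finset.range M, ∑ j ∈ Finset.range (l + 1),
          ρ s t * ‖cellKernel μ (q j) (F j) s t‖ₑ * ‖cellKernel μ (q l) (F l) s t‖ₑ := by
        simp only [mul_left_comm _ (2 : ℝ≥0∞), Finset.mul_sum, mul_assoc]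
    _ ≤ _ := by
        gcongr 2 * ∑ l ∈ Finset.range M, ∑ j ∈ Finset.range (l + 1), ?_ with l _ j _
        by_cases hst : q l s = q l t
        · gcongr
          · exact hρ l s t hst
          · exact enorm_cellKernel_le_cellDensity _ _ _
        · simp only [cellKernel_eq_zero hst, enorm_zero, mul_zero, le_refl]

lemma lintegral_mul_enorm_sum_cellKernel_sq_le (hq : ∀ j, FiniteMeasureFibers μ (q j))
    (hρ : ∀ l s t, q l s = q l t → ρ s t ≤ δ l) (F : ℕ → Finset ι) (M : ℕ) :
    ∫⁻ s, ∫⁻ t, ρ s t * ‖∑ j ∈ Finset.range M, cellKernel μ (q j) (F j) s t‖ₑ ^ 2 ∂μ ∂μ ≤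
      2 * ∑ l ∈ Finset.range M, ∑ j ∈ Finset.range (l + 1), δ l * (F j).card := by
  have hmeas (l : ℕ) (s : X) : AEMeasurable (fun t => ‖cellKernel μ (q l) (F l) s t‖ₑ) μ :=
    (((hq l).hasIntegralKernel_cellProj (F l)).memLp s).1.enorm
  have hinner (s : X) :
      ∫⁻ t, ρ s t * ‖∑ j ∈ Finset.range M, cellKernel μ (q j) (F j) s t‖ₑ ^ 2 ∂μ ≤
        2 * ∑ l ∈ Finset.range M, ∑ j ∈ Finset.range (l + 1),
          δ l * cellDensity μ (q j) (F j) s := by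
    refine (lintegral_mono (mul_enorm_sum_cellKernel_sq_le hρ F M s)).trans ?_
    rw [lintegral_const_mul' _ _ ENNReal.ofNat_ne_top, lintegral_finsetSum' _ fun l _ =>
      Finset.aemeasurable_fun_sum _ fun j _ => (hmeas l s).const_mul _]
    gcongr with l _
    rw [lintegral_finsetSum' _ fun j _ => (hmeas l s).const_mul _]
    gcongr with j _
    rw [lintegral_const_mul'' _ (hmeas l s)]
    exact mul_le_of_le_one_right' (lintegral_enorm_cellKernel_le_one _ _)
  have hdens (j : ℕ) : Measurable (cellDensity μ (q j) (F j)) :=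
    measurable_cellDensity fun i _ => (hq j).measurableSet i
  refine (lintegral_mono hinner).trans ?_
  rw [lintegral_const_mul' _ _ ENNReal.ofNat_ne_top, lintegral_finsetSum' _ fun l _ =>
    Finset.aemeasurable_fun_sum _ fun j _ => ((hdens j).const_mul _).aemeasurable]
  gcongr with l _
  rw [lintegral_finsetSum' _ fun j _ => ((hdens j).const_mul _).aemeasurable]
  gcongr with j _
  rw [lintegral_const_mul _ (hdens j)]
  gcongr
  exact lintegral_cellDensity_le_card fun i _ => (hq j).measurableSet i

lemma commL_sum_cellProj_sq_le {Ω : Set ℂ} {q : ℕ → ℂ → ι}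
    (hq : ∀ j, FiniteMeasureFibers (lebesgueOn Ω) (q j))
    (hδ : ∀ l s t, q l s = q l t → ‖s - t‖ₑ ^ 2 ≤ δ l) (F : ℕ → Finset ι) (M : ℕ) :
    commL (∑ j ∈ Finset.range M, (hq j).cellProj (F j)) ^ 2 ≤
      2 * ∑ l ∈ Finset.range M, ∑ j ∈ Finset.range (l + 1), δ l * (F j).card :=
  (HasIntegralKernel.sum fun j _ => (hq j).hasIntegralKernel_cellProj (F j)).commL_sq_le.trans
    (lintegral_mul_enorm_sum_cellKernel_sq_le hq hδ F M)

end Multiscale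

section StrongLimit

open Filter Topology

variable {𝕜 E F : Type*} [NontriviallyNormedField 𝕜] [SeminormedAddCommGroup E] [NormedSpace 𝕜 E]

lemma isClosed_setOf_tendsto_of_opNorm_le {α : Type*} [SeminormedAddCommGroup F] [NormedSpace 𝕜 F]
    {l : Filter α} {S : α → E →L[𝕜] F} {C : ℝ} (hS : ∀ a, ‖S a‖ ≤ C) (T : E →L[𝕜] F) :
    IsClosed {v | Tendsto (fun a => S a v) l (𝓝 (T v))} :=
  have hequi : Equicontinuous fun a => ⇑(S a) :=
    ((NormedSpace.equicontinuous_TFAE S).out 1 5).2 (⟨C, hS⟩ : ∃ C, ∀ a, ‖S a‖ ≤ C)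
  hequi.isClosed_setOfPred_tendsto T.continuous

lemma isClosed_setOf_cauchySeq_of_opNorm_le [SeminormedAddCommGroup F] [NormedSpace 𝕜 F]
    {S : ℕ → E →L[𝕜] F} {C : ℝ} (hS : ∀ n, ‖S n‖ ≤ C) :
    IsClosed {v | CauchySeq fun n => S n v} := by
  have hdiff (p : ℕ × ℕ) : ‖S p.1 - S p.2‖ ≤ C + C := norm_sub_le_of_le (hS _) (hS _)
  convert isClosed_setOf_tendsto_of_opNorm_le (l := atTop) hdiff 0 using 3 with v
  simp only [cauchySeq_iff_tendsto_dist_atTop_0, dist_eq_norm, sub_apply, zero_apply,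
    tendsto_zero_iff_norm_tendsto_zero (f := fun p : ℕ × ℕ => S p.1 v - S p.2 v)]

theorem exists_clm_forall_tendsto_of_dense [NormedAddCommGroup F] [NormedSpace 𝕜 F]
    [CompleteSpace F] {S : ℕ → E →L[𝕜] F} {C : ℝ} (hS : ∀ n, ‖S n‖ ≤ C) {s : Set E} (hs : Dense s)
    (hcauchy : ∀ v ∈ s, CauchySeq fun n => S n v) :
    ∃ T : E →L[𝕜] F, ∀ v, Tendsto (fun n => S n v) atTop (𝓝 (T v)) := by
  have hall (v : E) : CauchySeq fun n => S n v :=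
    (isClosed_setOf_cauchySeq_of_opNorm_le hS).closure_subset_iff.2 hcauchy (hs v)
  choose f hf using fun v => cauchySeq_tendsto_of_complete (hall v)
  exact ⟨.ofTendstoOfBoundedRange f S (tendsto_pi_nhds.2 hf)
    (isBounded_iff_forall_norm_le.2 ⟨C, Set.forall_mem_range.2 hS⟩), hf⟩

end StrongLimit

section CellApproximation

namespace FiniteMeasureFibers

variable {X ι : Type*} [MeasurableSpace X] {μ : Measure X} {q : X → ι}
  (hq : FiniteMeasureFibers μ q) (F : Finset ι)

lemma coeFn_sum_smul_cellVec (c : ι → ℂ) :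
    ⇑(∑ i ∈ F, c i • hq.cellVec i) =ᵐ[μ] (q ⁻¹' F).indicator (c ∘ q) := by
  have hF : ∀ᵐ s ∂μ, ∀ i ∈ F, (c i • hq.cellVec i) s =
      c i * (q ⁻¹' {i}).indicator (fun _ => 1) s := by
    refine (Finset.eventually_all F).2 fun i _ => ?_
    filter_upwards [Lp.coeFn_smul (c i) (hq.cellVec i), hq.coeFn_cellVec i] with s hsmul hs
    rw [hsmul, Pi.smul_apply, hs, smul_eq_mul]
  filter_upwards [Lp.coeFn_finsetSum F fun i => c i • hq.cellVec i, hF] with s hsum hs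
  rw [hsum, Finset.sum_apply, Finset.sum_congr rfl hs]
  by_cases hsF : q s ∈ F
  · rw [Finset.sum_eq_single_of_mem _ hsF fun i _ hi => by simp [hi.symm],
      Set.indicator_of_mem (s := q ⁻¹' F) (Finset.mem_coe.2 hsF)]
    simp
  · rw [Set.indicator_of_notMem (s := q ⁻¹' F) (mt Finset.mem_coe.1 hsF)]
    refine Finset.sum_eq_zero fun i hi => ?_
    rw [Set.indicator_of_notMem (s := q ⁻¹' {i}) fun h : q s = i => hsF (h.symm ▸ hi), mul_zero]

lemma norm_cellProj_toLp_sub_le {f : X → ℂ} (hf : MemLp f 2 μ) (c : ι → ℂ) {A : Set X}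
    (hA : MeasurableSet A) (hμA : μ A ≠ ∞) {η : ℝ}
    (h : ∀ s, ‖(q ⁻¹' F).indicator (c ∘ q) s - f s‖ ≤ A.indicator (fun _ => η) s) :
    ‖hq.cellProj F (hf.toLp f) - hf.toLp f‖ ≤ |η| * √(μ.real A) := by
  have hmem : ∑ i ∈ F, c i • hq.cellVec i ∈ Submodule.span ℂ (hq.cellVec '' F) :=
    sum_mem fun i hi => Submodule.smul_mem _ _ (Submodule.subset_span ⟨i, hi, rfl⟩)
  calc ‖hq.cellProj F (hf.toLp f) - hf.toLp f‖
      ≤ ‖hf.toLp f - ∑ i ∈ F, c i • hq.cellVec i‖ := by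
        rw [norm_sub_rev, cellProj, Submodule.starProjection_minimal]
        exact ciInf_le ⟨0, Set.forall_mem_range.2 fun _ => norm_nonneg _⟩
          (⟨_, hmem⟩ : Submodule.span ℂ (hq.cellVec '' F))
    _ ≤ ‖indicatorConstLp 2 hA hμA η‖ := by
        rw [norm_sub_rev]
        refine Lp.norm_le_norm_of_ae_le ?_
        filter_upwards [Lp.coeFn_sub (∑ i ∈ F, c i • hq.cellVec i) (hf.toLp f), hf.coeFn_toLp,
          hq.coeFn_sum_smul_cellVec F c, indicatorConstLp_coeFn (p := 2) (hs := hA) (hμs := hμA)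
            (c := η)] with s hsub hfs hcs hind
        rw [hsub, Pi.sub_apply, hfs, hcs, hind]
        exact (h s).trans (le_abs_self _)
    _ = |η| * √(μ.real A) := by
        rw [norm_indicatorConstLp two_ne_zero ENNReal.ofNat_ne_top, Real.norm_eq_abs,
          Real.sqrt_eq_rpow, ENNReal.toReal_ofNat]

end FiniteMeasureFibers

end CellApproximation

section Dyadic

open Filter Topology

/-- The index of the dyadic square `[m 2⁻ᵏ, (m + 1) 2⁻ᵏ) × [n 2⁻ᵏ, (n + 1) 2⁻ᵏ)` that contains
`s`. -/
noncomputable def dyadicIndex (k : ℕ) (s : ℂ) : ℤ × ℤ := (⌊2 ^ k * s.re⌋, ⌊2 ^ k * s.im⌋)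

/-- The lower left corner of the dyadic square of side `2⁻ᵏ` with index `i`. -/
noncomputable def dyadicCorner (k : ℕ) (i : ℤ × ℤ) : ℂ := ⟨i.1 / 2 ^ k, i.2 / 2 ^ k⟩

/-- The indices of the dyadic squares of side `2⁻ᵏ` that tile `[-N, N) × [-N, N)`. -/
noncomputable def dyadicBox (N k : ℕ) : Finset (ℤ × ℤ) :=
  Finset.Ico (-(N * 2 ^ k : ℤ)) (N * 2 ^ k) ×ˢ Finset.Ico (-(N * 2 ^ k : ℤ)) (N * 2 ^ k)

lemma measurable_dyadicIndex (k : ℕ) : Measurable (dyadicIndex k) :=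
  (Int.measurable_floor.comp (Complex.measurable_re.const_mul _)).prodMk
    (Int.measurable_floor.comp (Complex.measurable_im.const_mul _))

lemma norm_sub_le_of_dyadicIndex_eq {k : ℕ} {s t : ℂ} (h : dyadicIndex k s = dyadicIndex k t) :
    ‖s - t‖ ≤ 2 * (1 / 2) ^ k := by
  have hcoord {x y : ℝ} (hxy : ⌊2 ^ k * x⌋ = ⌊2 ^ k * y⌋) : |x - y| ≤ (1 / 2) ^ k := by
    have hlt := Int.abs_sub_lt_one_of_floor_eq_floor hxy
    rw [← mul_sub, abs_mul, abs_of_pos (by positivity)] at hlt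
    rw [one_div_pow, le_div_iff₀ (by positivity), mul_comm]
    exact hlt.le
  calc ‖s - t‖ ≤ |s.re - t.re| + |s.im - t.im| := Complex.norm_le_abs_re_add_abs_im (s - t)
    _ ≤ (1 / 2) ^ k + (1 / 2) ^ k :=
        add_le_add (hcoord (congrArg Prod.fst h)) (hcoord (congrArg Prod.snd h))
    _ = 2 * (1 / 2) ^ k := (two_mul _).symm

lemma enorm_sub_sq_le_of_dyadicIndex_eq {k : ℕ} {s t : ℂ}
    (h : dyadicIndex k s = dyadicIndex k t) : ‖s - t‖ₑ ^ 2 ≤ 4 * (4 ^ k)⁻¹ := by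
  have hsq : ‖s - t‖ ^ 2 ≤ 4 * (4 ^ k)⁻¹ :=
    calc ‖s - t‖ ^ 2 ≤ (2 * (1 / 2) ^ k) ^ 2 := by
          gcongr
          exact norm_sub_le_of_dyadicIndex_eq h
      _ = 4 * (4 ^ k)⁻¹ := by
          rw [mul_pow, ← pow_mul, mul_comm k, pow_mul, ← inv_pow]
          norm_num
  rw [← ofReal_norm, ← ENNReal.ofReal_pow (norm_nonneg _)]
  refine (ENNReal.ofReal_le_ofReal hsq).trans_eq ?_
  rw [ENNReal.ofReal_mul (by norm_num), ENNReal.ofReal_inv_of_pos (by positivity),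
    ENNReal.ofReal_pow (by norm_num), ENNReal.ofReal_ofNat]

lemma finiteMeasureFibers_dyadicIndex (μ : Measure ℂ) [IsFiniteMeasureOnCompacts μ] (k : ℕ) :
    FiniteMeasureFibers μ (dyadicIndex k) where
  measurableSet i := measurable_dyadicIndex k (measurableSet_singleton i)
  measure_ne_top _ := by
    refine (Bornology.IsBounded.measure_lt_top (Metric.isBounded_iff.2
      ⟨2 * (1 / 2) ^ k, fun s hs t ht => ?_⟩)).ne
    rw [dist_eq_norm]
    exact norm_sub_le_of_dyadicIndex_eq (Eq.trans hs (Eq.symm ht))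

lemma dyadicIndex_dyadicCorner (k : ℕ) (i : ℤ × ℤ) : dyadicIndex k (dyadicCorner k i) = i := by
  have h (n : ℤ) : (2 : ℝ) ^ k * (n / 2 ^ k) = n := by field_simp
  simp [dyadicIndex, dyadicCorner, h]

lemma card_dyadicBox (N k : ℕ) : (dyadicBox N k).card = 4 * N ^ 2 * 4 ^ k := by
  have hlen : ((N : ℤ) * 2 ^ k - -(N * 2 ^ k)).toNat = 2 * (N * 2 ^ k) := by
    rw [sub_neg_eq_add, ← two_mul]
    exact_mod_cast Int.toNat_natCast (2 * (N * 2 ^ k))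
  rw [dyadicBox, Finset.card_product, Int.card_Ico, hlen, show 4 = 2 * 2 from rfl, mul_pow]
  ring

lemma dyadicIndex_mem_dyadicBox {N : ℕ} (k : ℕ) {s : ℂ} (hs : ‖s‖ < N) :
    dyadicIndex k s ∈ dyadicBox N k := by
  have hcoord {x : ℝ} (hx : |x| < N) :
      ⌊2 ^ k * x⌋ ∈ Finset.Ico (-(N * 2 ^ k : ℤ)) (N * 2 ^ k) := by
    obtain ⟨hlower, hupper⟩ := abs_lt.1 hx
    have hpos : (0 : ℝ) < 2 ^ k := by positivity
    rw [Finset.mem_Ico, Int.le_floor, Int.floor_lt]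
    push_cast
    constructor <;> nlinarith
  exact Finset.mem_product.2 ⟨hcoord ((Complex.abs_re_le_norm s).trans_lt hs),
    hcoord ((Complex.abs_im_le_norm s).trans_lt hs)⟩

lemma norm_indicator_dyadicBox_sub_le {g : ℂ → ℂ} {R η : ℝ} {N k : ℕ}
    (hsupp : ∀ s, R ≤ ‖s‖ → g s = 0) (hN : R + 2 ≤ N)
    (hg : ∀ s t, ‖s - t‖ ≤ 2 * (1 / 2) ^ k → ‖g s - g t‖ ≤ η) (s : ℂ) :
    ‖(dyadicIndex k ⁻¹' dyadicBox N k).indicator ((g ∘ dyadicCorner k) ∘ dyadicIndex k) s - g s‖ ≤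
      (Metric.ball 0 (R + 2)).indicator (fun _ => η) s := by
  have hdist : ‖dyadicCorner k (dyadicIndex k s) - s‖ ≤ 2 * (1 / 2) ^ k :=
    norm_sub_le_of_dyadicIndex_eq (dyadicIndex_dyadicCorner k _)
  by_cases hs : ‖s‖ < R + 2
  · have hbox : s ∈ dyadicIndex k ⁻¹' dyadicBox N k :=
      Finset.mem_coe.2 (dyadicIndex_mem_dyadicBox k (hs.trans_le hN))
    rw [Set.indicator_of_mem hbox, Set.indicator_of_mem (mem_ball_zero_iff.2 hs)]
    exact hg _ _ hdist
  · have hfar : R ≤ ‖dyadicCorner k (dyadicIndex k s)‖ := by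
      have hpow : (1 / 2 : ℝ) ^ k ≤ 1 := pow_le_one₀ (by norm_num) (by norm_num)
      have htri := norm_sub_norm_le s (dyadicCorner k (dyadicIndex k s))
      rw [norm_sub_rev] at htri
      linarith
    have hcorner : ((g ∘ dyadicCorner k) ∘ dyadicIndex k) s = 0 := hsupp _ hfar
    rw [Set.indicator_of_notMem (mt mem_ball_zero_iff.1 hs), Set.indicator_apply_eq_zero.2
      fun _ => hcorner, hsupp s (by linarith), sub_zero, norm_zero]

/-- The conditional expectation onto the functions on `[-N, N) × [-N, N)` which are constant on the
dyadic squares of side `2⁻ᵏ`. -/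
noncomputable def dyadicProj (μ : Measure ℂ) [IsFiniteMeasureOnCompacts μ] (N k : ℕ) :
    Lp ℂ 2 μ →L[ℂ] Lp ℂ 2 μ :=
  (finiteMeasureFibers_dyadicIndex μ k).cellProj (dyadicBox N k)

variable {μ : Measure ℂ} [IsFiniteMeasureOnCompacts μ]

lemma tendsto_dyadicProj_toLp {g : ℂ → ℂ} (hgc : Continuous g) (hgs : HasCompactSupport g)
    (hg : MemLp g 2 μ) :
    Tendsto (fun p : ℕ × ℕ => dyadicProj μ p.1 p.2 (hg.toLp g)) atTop (𝓝 (hg.toLp g)) := by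
  obtain ⟨R, hR⟩ := hgs.isCompact.isBounded.subset_ball (0 : ℂ)
  have hsupp (s : ℂ) (hs : R ≤ ‖s‖) : g s = 0 := image_eq_zero_of_notMem_tsupport fun hmem =>
    hs.not_gt (mem_ball_zero_iff.1 (hR hmem))
  have hball : μ (Metric.ball 0 (R + 2)) ≠ ∞ := measure_ball_lt_top.ne
  refine Metric.tendsto_nhds.2 fun ε hε => ?_
  obtain ⟨η, hη, hηε⟩ := exists_pos_mul_lt hε √(μ.real (Metric.ball 0 (R + 2)))
  obtain ⟨δ, hδ, hgδ⟩ := Metric.uniformContinuous_iff.1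
    (hgs.uniformContinuous_of_continuous hgc) η hη
  have hfine : ∀ᶠ k : ℕ in atTop, 2 * (1 / 2 : ℝ) ^ k < δ := by
    have hpow := (tendsto_pow_atTop_nhds_zero_of_lt_one (r := (1 / 2 : ℝ)) (by norm_num)
      (by norm_num)).const_mul 2
    rw [mul_zero] at hpow
    exact hpow.eventually_lt_const hδ
  rw [← prod_atTop_atTop_eq]
  filter_upwards [tendsto_fst.eventually (tendsto_natCast_atTop_atTop.eventually_ge_atTop (R + 2)),
    tendsto_snd.eventually hfine] with p hN hk
  have hmod (s t : ℂ) (hst : ‖s - t‖ ≤ 2 * (1 / 2) ^ p.2) : ‖g s - g t‖ ≤ η := by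
    rw [← dist_eq_norm] at hst ⊢
    exact (hgδ (hst.trans_lt hk)).le
  rw [dist_eq_norm]
  calc ‖dyadicProj μ p.1 p.2 (hg.toLp g) - hg.toLp g‖
      ≤ |η| * √(μ.real (Metric.ball 0 (R + 2))) :=
        (finiteMeasureFibers_dyadicIndex μ p.2).norm_cellProj_toLp_sub_le (dyadicBox p.1 p.2) hg
          (g ∘ dyadicCorner p.2) measurableSet_ball hball
          (norm_indicator_dyadicBox_sub_le hsupp hN hmod)
    _ < ε := by rwa [abs_of_pos hη, mul_comm]

lemma tendsto_dyadicProj (h : Lp ℂ 2 μ) :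
    Tendsto (fun p : ℕ × ℕ => dyadicProj μ p.1 p.2 h) atTop (𝓝 h) := by
  have hclosed := isClosed_setOf_tendsto_of_opNorm_le (l := atTop)
    (S := fun p : ℕ × ℕ => dyadicProj μ p.1 p.2) (fun _ => FiniteMeasureFibers.norm_cellProj_le _ _)
    (ContinuousLinearMap.id ℂ (Lp ℂ 2 μ))
  refine hclosed.closure_subset_iff.2 ?_
    (Lp.dense_hasCompactSupport_contDiff (F := ℂ) (ENNReal.ofNat_ne_top (n := 2)) h)
  rintro f ⟨g, hfg, hgs, hgc⟩
  have hg : MemLp g 2 μ := hgc.continuous.memLp_of_hasCompactSupport hgs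
  obtain rfl : f = hg.toLp g := Lp.ext (hfg.trans hg.coeFn_toLp.symm)
  exact tendsto_dyadicProj_toLp hgc.continuous hgs hg

end Dyadic

section ApproximateUnit

open Filter Topology

lemma norm_inv_smul_sum_range_sub_le {𝕜 E : Type*} [RCLike 𝕜] [SeminormedAddCommGroup E]
    [NormedSpace 𝕜 E] {M : ℕ} (hM : M ≠ 0) {y : ℕ → E} {x : E} {ε : ℝ}
    (hy : ∀ j, ‖y j - x‖ ≤ ε) : ‖(M : 𝕜)⁻¹ • ∑ j ∈ Finset.range M, y j - x‖ ≤ ε := by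
  have hM' : (M : 𝕜) ≠ 0 := Nat.cast_ne_zero.2 hM
  calc ‖(M : 𝕜)⁻¹ • ∑ j ∈ Finset.range M, y j - x‖
      = ‖(M : 𝕜)⁻¹ • ∑ j ∈ Finset.range M, (y j - x)‖ := by
        rw [Finset.sum_sub_distrib, Finset.sum_const, Finset.card_range, smul_sub,
          ← Nat.cast_smul_eq_nsmul 𝕜, inv_smul_smul₀ hM']
    _ ≤ (M : ℝ)⁻¹ * ∑ _j ∈ Finset.range M, ε := by
        rw [norm_smul, norm_inv, RCLike.norm_natCast]
        gcongr
        exact norm_sum_le_of_le _ fun j _ => hy j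
    _ = ε := by
        rw [Finset.sum_const, Finset.card_range, nsmul_eq_mul,
          inv_mul_cancel_left₀ (Nat.cast_ne_zero.2 hM)]

lemma sum_card_dyadicBox_le (N n l : ℕ) :
    ∑ j ∈ Finset.range (l + 1), (dyadicBox N (n + j)).card ≤ 8 * N ^ 2 * 4 ^ (n + l) := by
  have hgeom : ∑ j ∈ Finset.range (l + 1), 4 ^ j ≤ 2 * 4 ^ l := by
    rw [Nat.geomSum_eq (by norm_num), pow_succ]
    omega
  calc ∑ j ∈ Finset.range (l + 1), (dyadicBox N (n + j)).card
      = 4 * N ^ 2 * 4 ^ n * ∑ j ∈ Finset.range (l + 1), 4 ^ j := by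
        simp only [card_dyadicBox, pow_add, Finset.mul_sum, mul_assoc]
    _ ≤ 4 * N ^ 2 * 4 ^ n * (2 * 4 ^ l) := by gcongr
    _ = 8 * N ^ 2 * 4 ^ (n + l) := by ring

lemma commL_sum_dyadicProj_sq_le (Ω : Set ℂ) (N n M : ℕ) :
    commL (∑ j ∈ Finset.range M, dyadicProj (lebesgueOn Ω) N (n + j)) ^ 2 ≤
      64 * N ^ 2 * M := by
  have hinner (l : ℕ) : ∑ j ∈ Finset.range (l + 1),
      4 * (4 ^ (n + l))⁻¹ * ((dyadicBox N (n + j)).card : ℝ≥0∞) ≤ 32 * N ^ 2 :=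
    calc ∑ j ∈ Finset.range (l + 1), 4 * (4 ^ (n + l))⁻¹ * ((dyadicBox N (n + j)).card : ℝ≥0∞)
        ≤ 4 * (4 ^ (n + l))⁻¹ * (8 * N ^ 2 * 4 ^ (n + l)) := by
          rw [← Finset.mul_sum]
          gcongr
          exact_mod_cast sum_card_dyadicBox_le N n l
      _ = 32 * N ^ 2 * ((4 ^ (n + l))⁻¹ * 4 ^ (n + l)) := by ring
      _ = 32 * N ^ 2 := by
          rw [ENNReal.inv_mul_cancel (by positivity) (by finiteness), mul_one]
  calc commL (∑ j ∈ Finset.range M, dyadicProj (lebesgueOn Ω) N (n + j)) ^ 2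
      ≤ 2 * ∑ l ∈ Finset.range M, ∑ j ∈ Finset.range (l + 1),
          4 * (4 ^ (n + l))⁻¹ * ((dyadicBox N (n + j)).card : ℝ≥0∞) :=
        commL_sum_cellProj_sq_le (fun j => finiteMeasureFibers_dyadicIndex _ (n + j))
          (fun _ _ _ => enorm_sub_sq_le_of_dyadicIndex_eq) (fun j => dyadicBox N (n + j)) M
    _ ≤ 2 * ∑ _l ∈ Finset.range M, 32 * (N : ℝ≥0∞) ^ 2 := by
        gcongr with l _
        exact hinner l
    _ = 64 * N ^ 2 * M := by
        rw [Finset.sum_const, Finset.card_range, nsmul_eq_mul]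
        ring

/-- The approximate unit: the mean of the `N²` consecutive scales `2⁻ᴺ, …, 2^(-N - N² + 1)` of
conditional expectations, on the square `[-N, N) × [-N, N)`. -/
noncomputable def approxUnit (μ : Measure ℂ) [IsFiniteMeasureOnCompacts μ] (N : ℕ) :
    Lp ℂ 2 μ →L[ℂ] Lp ℂ 2 μ :=
  ((N ^ 2 : ℕ) : ℂ)⁻¹ • ∑ j ∈ Finset.range (N ^ 2), dyadicProj μ N (N + j)

/-- The sum of the `N²` projections has `L ≤ 8 N²`, since `[-N, N) × [-N, N)` has area `4 N²`. -/
lemma commL_approxUnit_le (Ω : Set ℂ) (N : ℕ) : commL (approxUnit (lebesgueOn Ω) N) ≤ 8 := by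
  rcases eq_or_ne N 0 with rfl | hN
  · simp [approxUnit, commL_zero]
  have hN' : ((N ^ 2 : ℕ) : ℂ) ≠ 0 := by exact_mod_cast pow_ne_zero 2 hN
  have hsum : commL (∑ j ∈ Finset.range (N ^ 2), dyadicProj (lebesgueOn Ω) N (N + j)) ≤
      8 * (N ^ 2 : ℕ) := by
    rw [← ENNReal.pow_le_pow_left_iff two_ne_zero]
    refine (commL_sum_dyadicProj_sq_le Ω N N (N ^ 2)).trans_eq ?_
    push_cast
    ring
  calc commL (approxUnit (lebesgueOn Ω) N)
      ≤ ‖((N ^ 2 : ℕ) : ℂ)⁻¹‖ₑ * (8 * (N ^ 2 : ℕ)) := by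
        grw [approxUnit, commL_smul_le, hsum]
    _ = 8 * (((N ^ 2 : ℕ) : ℝ≥0∞)⁻¹ * (N ^ 2 : ℕ)) := by
        rw [enorm_inv hN', ← ofReal_norm, Complex.norm_natCast, ENNReal.ofReal_natCast]
        ring
    _ ≤ 8 := mul_le_of_le_one_right' (ENNReal.inv_mul_le_one _)

variable (μ : Measure ℂ) [IsFiniteMeasureOnCompacts μ] (N : ℕ)

lemma isSelfAdjoint_approxUnit : IsSelfAdjoint (approxUnit μ N) := by
  have hsum : IsSelfAdjoint (∑ j ∈ Finset.range (N ^ 2), dyadicProj μ N (N + j)) :=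
    isSelfAdjoint_sum _ fun j _ => FiniteMeasureFibers.isSelfAdjoint_cellProj _ _
  exact IsSelfAdjoint.smul (IsSelfAdjoint.natCast (N ^ 2)).inv₀ hsum

lemma isCompactOperator_approxUnit : IsCompactOperator (approxUnit μ N) :=
  Submodule.smul_mem (compactOperator (RingHom.id ℂ) (Lp ℂ 2 μ) (Lp ℂ 2 μ)) _
    (Submodule.sum_mem _ fun _ _ => FiniteMeasureFibers.isCompactOperator_cellProj _ _)

lemma norm_approxUnit_le : ‖approxUnit μ N‖ ≤ 1 := by
  rcases eq_or_ne N 0 with rfl | hN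
  · simp [approxUnit]
  · simpa only [approxUnit, sub_zero] using norm_inv_smul_sum_range_sub_le (𝕜 := ℂ) (x := 0)
      (pow_ne_zero 2 hN) (y := fun j => dyadicProj μ N (N + j)) fun j => by
        rw [sub_zero]
        exact FiniteMeasureFibers.norm_cellProj_le _ _

variable {μ}

lemma tendsto_approxUnit (h : Lp ℂ 2 μ) :
    Tendsto (fun N => approxUnit μ N h) atTop (𝓝 h) := by
  refine Metric.tendsto_nhds.2 fun ε hε => ?_
  obtain ⟨p, hp⟩ := eventually_atTop.1
    (Metric.tendsto_nhds.1 (tendsto_dyadicProj h) (ε / 2) (half_pos hε))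
  filter_upwards [eventually_ge_atTop p.1, eventually_ge_atTop p.2, eventually_ne_atTop 0]
    with N hp₁ hp₂ hN
  have hscale (j : ℕ) : ‖dyadicProj μ N (N + j) h - h‖ ≤ ε / 2 := by
    rw [← dist_eq_norm]
    exact (hp (N, N + j) ⟨hp₁, hp₂.trans (Nat.le_add_right N j)⟩).le
  rw [dist_eq_norm, approxUnit, smul_apply, sum_apply]
  exact (norm_inv_smul_sum_range_sub_le (pow_ne_zero 2 hN) hscale).trans_lt (half_lt_self hε)

end ApproximateUnit

section DoubleCentralizer

open Filter Topology

variable {𝕜 H A : Type*} [RCLike 𝕜] [NormedAddCommGroup H] [InnerProductSpace 𝕜 H]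
  [CompleteSpace H] [Mul A] {π : A →ₙ* (H →L[𝕜] H)} {e : ℕ → A} {L R : A → A}

lemma tendsto_star_apply_star_of_central (he : ∀ n, IsSelfAdjoint (π (e n)))
    (hlim : ∀ v, Tendsto (fun n => π (e n) v) atTop (𝓝 v)) (hc : ∀ x y, L x * y = x * R y)
    (x : A) (u : H) :
    Tendsto (fun n => star (π (R (e n))) (star (π x) u)) atTop (𝓝 (star (π (L x)) u)) := by
  refine (hlim (star (π (L x)) u)).congr fun n => ?_
  have hstar : π (e n) * star (π (L x)) = star (π (R (e n))) * star (π x) := by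
    rw [← star_mul, ← map_mul, ← hc, map_mul, star_mul, (he n).star_eq]
  exact DFunLike.congr_fun hstar u

/-- The operator is recovered as the adjoint of the strong limit of the `π (R (e n))†`: the
identity `L x * e n = x * R (e n)` makes them converge on the ranges of the `π x†`. -/
theorem exists_clm_of_central (he : ∀ n, IsSelfAdjoint (π (e n)))
    (hlim : ∀ v, Tendsto (fun n => π (e n) v) atTop (𝓝 v)) (hc : ∀ x y, L x * y = x * R y)
    {C : ℝ} (hR : ∀ n, ‖π (R (e n))‖ ≤ C) :
    ∃ T : H →L[𝕜] H, ∀ x, π (L x) = π x * T ∧ π (R x) = T * π x := by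
  have hdense : Dense {v | ∃ x u, star (π x) u = v} := fun v =>
    mem_closure_of_tendsto (hlim v) (.of_forall fun n => ⟨e n, v, by rw [(he n).star_eq]⟩)
  obtain ⟨S, hS⟩ := exists_clm_forall_tendsto_of_dense (S := fun n => star (π (R (e n))))
    (fun n => (norm_star _).trans_le (hR n)) hdense (by
      rintro _ ⟨x, u, rfl⟩
      exact (tendsto_star_apply_star_of_central he hlim hc x u).cauchySeq)
  have hL (x : A) : π (L x) = π x * star S := by
    rw [← star_inj, star_mul, star_star]
    ext u
    exact tendsto_nhds_unique (tendsto_star_apply_star_of_central he hlim hc x u) (hS _)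
  refine ⟨star S, fun x => ⟨hL x, ?_⟩⟩
  ext v
  refine tendsto_nhds_unique (hlim (π (R x) v)) ((hlim (star S (π x v))).congr fun n => ?_)
  have hn : π (e n) * star S * π x = π (e n) * π (R x) := by
    rw [← hL, ← map_mul, hc, map_mul]
  exact DFunLike.congr_fun hn v

end DoubleCentralizer

namespace KLambda

open Filter Topology

variable {Ω : Set ℂ}

/-- The approximate unit of `𝒦Λ(Ω)`: bounded for `⦀·⦀`, and converging strongly to `1`. -/
noncomputable def approxUnit (Ω : Set ℂ) (N : ℕ) : KLambda Ω :=
  ⟨_root_.approxUnit (lebesgueOn Ω) N, (commL_approxUnit_le Ω N).trans_lt (by norm_num),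
    isCompactOperator_approxUnit _ N⟩

lemma tendsto_toOp_approxUnit (v : L2 Ω) :
    Tendsto (fun N => (approxUnit Ω N).toOp v) atTop (𝓝 v) :=
  _root_.tendsto_approxUnit v

lemma norm_approxUnit_le (N : ℕ) : ‖approxUnit Ω N‖ ≤ 9 := by
  have hop : ‖(approxUnit Ω N).toOp‖ ≤ 1 := _root_.norm_approxUnit_le _ N
  have hcomm : (commL (approxUnit Ω N).toOp).toReal ≤ 8 :=
    ENNReal.toReal_le_of_le_ofReal (by norm_num)
      ((commL_approxUnit_le Ω N).trans_eq (by norm_num))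
  rw [norm_def]
  linarith

lemma norm_toOp_le (x : KLambda Ω) : ‖x.toOp‖ ≤ ‖x‖ :=
  le_add_of_nonneg_right ENNReal.toReal_nonneg

lemma commL_toOp_le (x : KLambda Ω) : commL x.toOp ≤ ENNReal.ofReal ‖x‖ :=
  (ENNReal.le_ofReal_iff_toReal_le x.commL_ne_top (norm_nonneg x)).2
    (le_add_of_nonneg_left (norm_nonneg x.toOp))

lemma op_ext {S T : BL2 Ω} (h : ∀ x : KLambda Ω, S * x.toOp = T * x.toOp) : S = T := by
  ext1 v
  refine tendsto_nhds_unique ((S.continuous.tendsto v).comp (tendsto_toOp_approxUnit v))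
    (((T.continuous.tendsto v).comp (tendsto_toOp_approxUnit v)).congr fun N => ?_)
  exact (DFunLike.congr_fun (h (approxUnit Ω N)) v).symm

lemma mem_ELambda_of_map_eq_mul (R : KLambda Ω →L[ℂ] KLambda Ω) {T : BL2 Ω}
    (hT : ∀ x, (R x).toOp = T * x.toOp) : T ∈ ELambda Ω := by
  have hbound (N : ℕ) : commL (R (approxUnit Ω N)).toOp ≤ ENNReal.ofReal (‖R‖ * 9) :=
    (commL_toOp_le _).trans (ENNReal.ofReal_le_ofReal (R.le_of_opNorm_le_of_le le_rfl
      (norm_approxUnit_le N)))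
  refine (commL_le_of_tendsto (l := atTop) (fun v => ?_) hbound).trans_lt ENNReal.ofReal_lt_top
  simp_rw [hT]
  exact (T.continuous.tendsto v).comp (tendsto_toOp_approxUnit v)

theorem exists_op_of_central {L R : KLambda Ω →L[ℂ] KLambda Ω}
    (hc : ∀ x y : KLambda Ω, L x * y = x * R y) :
    ∃ T : ELambda Ω, ∀ x : KLambda Ω,
      (L x).toOp = x.toOp * (T : BL2 Ω) ∧ (R x).toOp = (T : BL2 Ω) * x.toOp := by
  obtain ⟨T, hT⟩ := exists_clm_of_central (π := ⟨toOp, toOp_mul⟩) (e := approxUnit Ω)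
    (fun N => isSelfAdjoint_approxUnit _ N) tendsto_toOp_approxUnit hc
    fun N => (norm_toOp_le _).trans (R.le_of_opNorm_le_of_le le_rfl (norm_approxUnit_le N))
  exact ⟨⟨T, mem_ELambda_of_map_eq_mul R fun x => (hT x).2⟩, hT⟩

lemma norm_add_commL_mul_le {S T : BL2 Ω} (hS : commL S ≠ ∞) (hT : commL T ≠ ∞) :
    ‖S * T‖ + (commL (S * T)).toReal ≤
      (‖S‖ + (commL S).toReal) * (‖T‖ + (commL T).toReal) := by
  have hST : commL S * ‖T‖ₑ ≠ ∞ := ENNReal.mul_ne_top hS enorm_ne_top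
  have hTS : ‖S‖ₑ * commL T ≠ ∞ := ENNReal.mul_ne_top enorm_ne_top hT
  have hcomm : (commL (S * T)).toReal ≤ (commL S).toReal * ‖T‖ + ‖S‖ * (commL T).toReal := by
    refine (ENNReal.toReal_mono (ENNReal.add_ne_top.2 ⟨hST, hTS⟩) (commL_mul_le S T)).trans_eq ?_
    rw [ENNReal.toReal_add hST hTS, ENNReal.toReal_mul, ENNReal.toReal_mul, toReal_enorm,
      toReal_enorm]
  have hnonneg : 0 ≤ (commL S).toReal * (commL T).toReal := by positivity
  linarith [norm_mul_le S T]

/-- Multiplication by `T ∈ EΛ(Ω)` from the left on its ideal `𝒦Λ(Ω)`. -/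
noncomputable def mulLeft (T : ELambda Ω) : KLambda Ω →L[ℂ] KLambda Ω :=
  LinearMap.mkContinuous
    { toFun := fun x => ⟨(T : BL2 Ω) * x.toOp, mul_mem T.2 x.toOp_mem, x.toOp_compact.clm_comp _⟩
      map_add' := fun _ _ => toOp_injective (mul_add _ _ _)
      map_smul' := fun _ _ => toOp_injective (mul_smul_comm _ _ _) }
    (‖(T : BL2 Ω)‖ + (commL (T : BL2 Ω)).toReal)
    fun x => norm_add_commL_mul_le (LT.lt.ne T.2) x.commL_ne_top

/-- Multiplication by `T ∈ EΛ(Ω)` from the right on its ideal `𝒦Λ(Ω)`. -/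
noncomputable def mulRight (T : ELambda Ω) : KLambda Ω →L[ℂ] KLambda Ω :=
  LinearMap.mkContinuous
    { toFun := fun x => ⟨x.toOp * (T : BL2 Ω), mul_mem x.toOp_mem T.2, x.toOp_compact.comp_clm _⟩
      map_add' := fun _ _ => toOp_injective (add_mul _ _ _)
      map_smul' := fun _ _ => toOp_injective (smul_mul_assoc _ _ _) }
    (‖(T : BL2 Ω)‖ + (commL (T : BL2 Ω)).toReal)
    fun x => (norm_add_commL_mul_le x.commL_ne_top (LT.lt.ne T.2)).trans_eq (mul_comm _ _)

lemma doubleCentralizer_ext {a b : 𝓜(ℂ, KLambda Ω)}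
    (hfst : ∀ x, (a.fst x).toOp = (b.fst x).toOp) (hsnd : ∀ x, (a.snd x).toOp = (b.snd x).toOp) :
    a = b :=
  DoubleCentralizer.ext _ _ _ _ (Prod.ext
    (ContinuousLinearMap.ext fun x => toOp_injective (hfst x))
    (ContinuousLinearMap.ext fun x => toOp_injective (hsnd x)))

/-- The action of `EΛ(Ω)` on its ideal `𝒦Λ(Ω)` by double centralizers. -/
noncomputable def toDoubleCentralizer (Ω : Set ℂ) : ELambda Ω →ₐ[ℂ] 𝓜(ℂ, KLambda Ω) where
  toFun T := ⟨(mulLeft T, mulRight T), fun _ _ => toOp_injective (mul_assoc _ _ _)⟩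
  map_one' := doubleCentralizer_ext (fun _ => one_mul _) fun _ => mul_one _
  map_mul' _ _ := doubleCentralizer_ext (fun _ => mul_assoc _ _ _) fun _ => (mul_assoc _ _ _).symm
  map_zero' := doubleCentralizer_ext (fun _ => zero_mul _) fun _ => mul_zero _
  map_add' _ _ := doubleCentralizer_ext (fun _ => add_mul _ _ _) fun _ => mul_add _ _ _
  commutes' c := doubleCentralizer_ext
    (fun x => by
      rw [DoubleCentralizer.algebraMap_fst]
      exact (Algebra.smul_def c x.toOp).symm)
    fun x => by
      rw [DoubleCentralizer.algebraMap_snd]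
      exact (Algebra.commutes c x.toOp).symm.trans (Algebra.smul_def c x.toOp).symm

lemma bijective_toDoubleCentralizer (Ω : Set ℂ) :
    Function.Bijective (toDoubleCentralizer Ω) := by
  refine ⟨fun S T h => Subtype.ext (op_ext fun x => ?_), fun a => ?_⟩
  · exact congrArg (fun a : 𝓜(ℂ, KLambda Ω) => (a.fst x).toOp) h
  · obtain ⟨T, hT⟩ := exists_op_of_central a.central
    exact ⟨T, doubleCentralizer_ext (fun x => (hT x).2.symm) fun x => (hT x).1.symm⟩

end KLambda

theorem mainTheorem7 (Ω : Set ℂ) (hΩ : MeasurableSet Ω) :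
    (∃ Φ : ELambda Ω ≃ₐ[ℂ] 𝓜(ℂ, KLambda Ω), ∀ (T : ELambda Ω) (x : KLambda Ω),
      ((Φ T).snd x).toOp = x.toOp * (T : BL2 Ω) ∧ ((Φ T).fst x).toOp = (T : BL2 Ω) * x.toOp) ∧
    ∀ T' T'' : KLambda Ω →L[ℂ] KLambda Ω, (∀ x y : KLambda Ω, T' x * y = x * T'' y) →
      ∃! T : ELambda Ω, ∀ x : KLambda Ω,
        (T' x).toOp = x.toOp * (T : BL2 Ω) ∧ (T'' x).toOp = (T : BL2 Ω) * x.toOp := by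
  refine ⟨⟨AlgEquiv.ofBijective (KLambda.toDoubleCentralizer Ω)
    (KLambda.bijective_toDoubleCentralizer Ω), fun T x => ⟨rfl, rfl⟩⟩, fun T' T'' hc => ?_⟩
  obtain ⟨T, hT⟩ := KLambda.exists_op_of_central hc
  exact ⟨T, hT, fun S hS => Subtype.ext (KLambda.op_ext fun x =>
    (hS x).2.symm.trans (hT x).2)⟩
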